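/- For integers $d,n\ge 1$ and a real number $r>0$, the random geometric graph $G_d(n,r)$ has $n$ vertices $1,\dots,n$ and is obtained from $n$ independent uniformly distributed random points $X_1,\dots,X_n$ of $[0,1]^d$ by joining distinct $i,j$ if and only if $\lVert X_i-X_j\rVert\le r$, where $\lVert\cdot\rVert$ is the Euclidean norm. For $\alpha\in[0,1]$, an $\alpha$-subgraph of a graph $G$ is a spanning subgraph $H\subseteq G$ such that $d_H(v)\ge\alpha\, d_G(v)$ for every vertex $v$ of $G$. A graph is Hamiltonian if it contains a cycle through all of its vertices. Let $\theta_d$ be the volume of the unit ball of $\mathbb{R}^d$ and $\log$ the natural logarithm. **Theorem.** For every integer $d\ge 1$ and every $\epsilon\in\bigl(0,\tfrac{1}{2d^{d/2}\theta_d}\bigr]$ there exists a constant $C_4=C_4(d,\epsilon)>0$ such that the following holds. Let $r=r(n)$ be any sequence of real numbers with $r(n)\to 0$ as $n\to\infty$ and $r(n)\ge C_4(\log n/n)^{1/d}$ for all sufficiently large $n$. Then the probability that every $\bigl(1-\tfrac{1}{2d^{d/2}\theta_d}+\epsilon\bigr)$-subgraph of $G_d(n,r(n))$ is Hamiltonian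 tends to $1$ as $n\to\infty$. -/

import Mathlib

open MeasureTheory Filter Topology

noncomputable section

/-- The volume of the unit ball in `d`-dimensional Euclidean space. -/
def unitBallVolume (d : ℕ) : ℝ :=
  (volume (Metric.ball (0 : EuclideanSpace ℝ (Fin d)) 1)).toReal

/-- The cube `[0,1]^d`, as a subset of `d`-dimensional Euclidean space. -/
def unitCube (d : ℕ) : Set (EuclideanSpace ℝ (Fin d)) :=
  {x | ∀ i, x i ∈ Set.Icc (0 : ℝ) 1}

/-- The uniform distribution on `[0,1]^d`: Lebesgue measure conditioned on the cube. -/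
def uniformCube (d : ℕ) : Measure (EuclideanSpace ℝ (Fin d)) :=
  ProbabilityTheory.cond volume (unitCube d)

/-- The joint law of `n` mutually independent uniform random points of `[0,1]^d`. -/
def uniformPoints (d n : ℕ) : Measure (Fin n → EuclideanSpace ℝ (Fin d)) :=
  Measure.pi fun _ => uniformCube d

/-- The geometric graph of the points `x 0, …, x (n-1)`: distinct `i` and `j` are adjacent exactly
when the Euclidean distance of `x i` and `x j` is at most `r`. If `x` is distributed according to
`uniformPoints d n`, this is the random geometric graph `G_d(n,r)`. -/
def geometricGraph {d n : ℕ} (r : ℝ) (x : Fin n → EuclideanSpace ℝ (Fin d)) :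
    SimpleGraph (Fin n) where
  Adj i j := i ≠ j ∧ ‖x i - x j‖ ≤ r
  symm := ⟨fun i j h => ⟨h.1.symm, by rw [norm_sub_rev]; exact h.2⟩⟩
  loopless := ⟨fun _ h => h.1 rfl⟩

open Classical in
/-- `H` is an `α`-subgraph of `G`: a (spanning) subgraph in which every vertex keeps at least an
`α`-proportion of its degree. -/
def IsAlphaSubgraph {V : Type*} [Fintype V] (α : ℝ) (H G : SimpleGraph V) : Prop :=
  H ≤ G ∧ ∀ v : V, α * (G.degree v : ℝ) ≤ (H.degree v : ℝ)

lemma volume_unitCube (d : ℕ) : volume (unitCube d) = 1 := by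
  have h : unitCube d = (WithLp.ofLp : EuclideanSpace ℝ (Fin d) → Fin d → ℝ) ⁻¹'
      (Set.univ.pi fun _ => Set.Icc (0 : ℝ) 1) := by
    ext x; simp [unitCube, Pi.le_def, forall_and]
  rw [h, (PiLp.volume_preserving_ofLp (Fin d)).measure_preimage
    (MeasurableSet.univ_pi fun _ => measurableSet_Icc).nullMeasurableSet, volume_pi_pi]
  simp

instance (d : ℕ) : IsProbabilityMeasure (uniformCube d) :=
  ProbabilityTheory.cond_isProbabilityMeasure_of_finite (by rw [volume_unitCube]; exact one_ne_zero)
    (by rw [volume_unitCube]; exact ENNReal.one_ne_top)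

instance (d n : ℕ) : IsProbabilityMeasure (uniformPoints d n) := by
  unfold uniformPoints; infer_instance

end

/-! Cut the cube into `L ^ d` grid cubes, with `L` least such that their diameter is at most `r`.
Asymptotically, each cube has volume `r ^ d / A` with `A = d ^ (d / 2)`. Points in one cube form a
clique of the geometric graph. For two cubes sharing a face, the halves next to that face together
form a box of the same size, so these halves are completely joined. By Chernoff bounds, with high
probability every half cube holds about `n * r ^ d / (2 * A)` points and every degree is at most
about `n * θ * r ^ d`. An α-subgraph therefore loses at most some `D` edges per vertex, and the
choice of α makes `D` smaller than the content of every half cube (`uniformPoints_compl_le_div`).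

The rest is deterministic (`isHamiltonian_of_halfCell`). A cube has more than `2 * D` points, so
what remains inside it satisfies a Dirac-type condition and is Hamilton-connected
(`hasPathOn_of_degree`), even after removing three vertices. Neighbouring cubes remain linked. A
snake through the grid (`exists_snake`) orders the cubes, and `hasPathOn_chain` nests an excursion
through all later cubes inside a spanning path of the current one. -/

/-! ### Hamilton-connectedness from large degrees -/

section HamiltonPaths

variable {V : Type*}

open Classical in
/-- The number of consecutive entries of a list that are not related by `R`. -/
noncomputable def chainDefect (R : V → V → Prop) : List V → ℕ
  | [] => 0
  | [_] => 0
  | a :: b :: l => (if R a b then 0 else 1) + chainDefect R (b :: l)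

open Classical in
lemma chainDefect_append (R : V → V → Prop) (a b : V) (l₂ : List V) :
    ∀ l₁ : List V, chainDefect R (l₁ ++ [a] ++ b :: l₂) =
      chainDefect R (l₁ ++ [a]) + (if R a b then 0 else 1) + chainDefect R (b :: l₂)
  | [] => by simp [chainDefect]
  | [c] => by simp [chainDefect]; ring
  | c :: e :: l => by
      have := chainDefect_append R a b l₂ (e :: l)
      simp only [List.cons_append, chainDefect] at this ⊢
      rw [this]; ring

lemma chainDefect_reverse (R : V → V → Prop) (hR : ∀ a b, R a b → R b a) :
    ∀ l : List V, chainDefect R l.reverse = chainDefect R l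
  | [] => rfl
  | [a] => rfl
  | a :: b :: l => by
      have ih := chainDefect_reverse R hR (b :: l)
      have h := chainDefect_append R b a [] l.reverse
      simp only [List.reverse_cons, List.append_assoc] at ih h ⊢
      rw [h, ih]
      have : R b a ↔ R a b := ⟨hR _ _, hR _ _⟩
      by_cases hab : R a b <;> simp [chainDefect, hab, this, add_comm]

lemma chainDefect_eq_zero (R : V → V → Prop) :
    ∀ l : List V, chainDefect R l = 0 ↔ l.IsChain R
  | [] => by simp [chainDefect]
  | [a] => by simp [chainDefect]
  | a :: b :: l => by
      have ih := chainDefect_eq_zero R (b :: l)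
      by_cases h : R a b <;> simp [chainDefect, h, ih]

/-- `l` lists the elements of `S` exactly once, beginning with `u` and ending with `v`. -/
structure IsListing (S : Set V) (u v : V) (l : List V) : Prop where
  nodup : l.Nodup
  mem_iff : ∀ x, x ∈ l ↔ x ∈ S
  head : l.head? = some u
  last : l.getLast? = some v

/-- `H` has a path from `u` to `v` whose vertex set is `S`. -/
def HasPathOn (H : SimpleGraph V) (S : Set V) (u v : V) : Prop :=
  ∃ l, IsListing S u v l ∧ l.IsChain H.Adj

/-- Reversing the segment between positions `i` and `j` (excluded and included) of a list. -/
lemma exists_lt_defect {H : SimpleGraph V} {S : Set V} {u v : V} {l : List V}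
    (hl : IsListing S u v l) {a b : ℕ} (hab : a < b) (hb : b + 1 < l.length)
    (h₁ : H.Adj l[a] l[b]) (h₂ : H.Adj l[a + 1] l[b + 1])
    (h₃ : ¬ H.Adj l[a] l[a + 1] ∨ ¬ H.Adj l[b] l[b + 1]) :
    ∃ l', IsListing S u v l' ∧ chainDefect H.Adj l' < chainDefect H.Adj l := by
  obtain ⟨A, hA⟩ : ∃ A, A = l.take a := ⟨_, rfl⟩
  obtain ⟨M, hM⟩ : ∃ M, M = (l.drop (a + 1)).take (b - a) := ⟨_, rfl⟩
  obtain ⟨B, hB⟩ : ∃ B, B = l.drop (b + 2) := ⟨_, rfl⟩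
  have e1 : l.take (a + 1) = A ++ [l[a]] := by
    rw [hA, List.take_succ_eq_append_getElem (by omega)]
  have e2 : l.drop (b + 1) = l[b + 1] :: B := by
    rw [hB, List.drop_eq_getElem_cons hb]
  have hl' : l = (A ++ [l[a]]) ++ (M ++ l[b + 1] :: B) := by
    rw [← e1, ← e2, hM]
    have : l.drop (b + 1) = (l.drop (a + 1)).drop (b - a) := by
      rw [List.drop_drop]; congr 1; omega
    rw [this, List.take_append_drop, List.take_append_drop]
  have hMh : ∃ M', M = l[a + 1] :: M' := by
    rw [hM, List.drop_eq_getElem_cons (by omega)]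
    obtain ⟨k, hk⟩ : ∃ k, b - a = k + 1 := ⟨b - a - 1, by omega⟩
    rw [hk, List.take_succ_cons]; exact ⟨_, rfl⟩
  have hMl : ∃ M', M = M' ++ [l[b]] := by
    obtain ⟨k, hk⟩ : ∃ k, b - a = k + 1 := ⟨b - a - 1, by omega⟩
    rw [hM, hk, List.take_succ_eq_append_getElem (by simp; omega)]
    refine ⟨((l.drop (a + 1)).take k), ?_⟩
    congr 2
    simp only [List.getElem_drop]
    congr 1; omega
  obtain ⟨M₁, hM₁⟩ := hMh
  obtain ⟨M₂, hM₂⟩ := hMl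
  have hperm : (A ++ [l[a]] ++ (M.reverse ++ l[b + 1] :: B)).Perm l := by
    conv_rhs => rw [hl']
    exact ((List.reverse_perm M).append_right _).append_left _
  refine ⟨A ++ [l[a]] ++ (M.reverse ++ l[b + 1] :: B), ⟨hperm.nodup_iff.2 hl.nodup,
    fun x => hperm.mem_iff.trans (hl.mem_iff x), ?_, ?_⟩, ?_⟩
  · rw [← hl.head]; conv_rhs => rw [hl']
    cases A <;> simp
  · rw [← hl.last]; conv_rhs => rw [hl']
    simp [List.getLast?_append, List.getLast?_cons]
  · have r1 : M.reverse = l[b] :: M₂.reverse := by rw [hM₂]; simp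
    have r2 : M.reverse = M₁.reverse ++ [l[a + 1]] := by rw [hM₁]; simp
    -- Reversal changes only the two joints of the segment: both new ones are edges, while one of
    -- the old ones was not.
    have d1 : chainDefect H.Adj (A ++ [l[a]] ++ (M.reverse ++ l[b + 1] :: B)) =
        chainDefect H.Adj (A ++ [l[a]]) + chainDefect H.Adj M +
          chainDefect H.Adj (l[b + 1] :: B) := by
      conv_lhs => rw [r1]
      rw [List.cons_append, chainDefect_append, if_pos h₁, ← List.cons_append, ← r1, r2,
        chainDefect_append, if_pos h₂, ← r2, chainDefect_reverse _ (fun _ _ h => h.symm)]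
      ring
    classical
    have d2 : chainDefect H.Adj l = chainDefect H.Adj (A ++ [l[a]]) +
        (if H.Adj l[a] l[a + 1] then 0 else 1) + chainDefect H.Adj M +
        (if H.Adj l[b] l[b + 1] then 0 else 1) + chainDefect H.Adj (l[b + 1] :: B) := by
      have : chainDefect H.Adj l = chainDefect H.Adj ((A ++ [l[a]]) ++ (M ++ l[b + 1] :: B)) :=
        congrArg _ hl'
      rw [this]
      conv_lhs => rw [hM₁]
      rw [List.cons_append, chainDefect_append, ← List.cons_append, ← hM₁, hM₂,
        chainDefect_append]
      ring
    rw [d1, d2]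
    rcases h₃ with h | h <;> rw [if_neg h] <;> split_ifs <;> omega

open Classical in
/-- An Ore-type condition for Hamilton-connectedness of an induced subgraph. -/
lemma hasPathOn_of_degree (H : SimpleGraph V) (S : Finset V)
    (hdeg : ∀ x ∈ S, S.card + 1 ≤ 2 * (S.filter (H.Adj x)).card)
    {u v : V} (hu : u ∈ S) (hv : v ∈ S) (huv : u ≠ v) : HasPathOn H S u v := by
  have hex : ∃ k l, IsListing (S : Set V) u v l ∧ chainDefect H.Adj l = k := by
    refine ⟨_, u :: (((S.erase u).erase v).toList ++ [v]), ⟨?_, ?_, ?_, ?_⟩, rfl⟩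
    · simp +contextual [List.nodup_append, Finset.nodup_toList, huv]
    · intro x
      by_cases h1 : x = u <;> by_cases h2 : x = v <;> simp [h1, h2, hu, hv]
    · simp
    · simp [List.getLast?_cons]
  -- Take a listing with the fewest non-edges; a remaining non-edge at position `i` will be removed
  -- by a reversal.
  obtain ⟨l, hl, hk⟩ := Nat.find_spec hex
  have hmin : ∀ l', IsListing (S : Set V) u v l' →
      chainDefect H.Adj l ≤ chainDefect H.Adj l' := fun l' hl' =>
    hk ▸ Nat.find_min' hex ⟨l', hl', rfl⟩
  refine ⟨l, hl, ?_⟩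
  by_contra hch
  have hlen : l.length = S.card := by
    rw [← List.toFinset_card_of_nodup hl.nodup]
    congr 1; ext x; simp [hl.mem_iff]
  obtain ⟨i, hi, hbad⟩ := List.exists_not_getElem_of_not_isChain hch
  have hmemS : ∀ (k : ℕ) (hk : k < l.length), l[k] ∈ S := fun k hk => by
    have := (hl.mem_iff l[k]).1 (List.getElem_mem hk)
    simpa using this
  set N := S.card with hN
  -- A position in both `A` and `A'` permits the reversal. Each set misses at most one neighbour:
  -- `A` the last entry `v`, `A'` the first entry `u`.
  set A := (Finset.range (N - 1)).filter fun j => ∃ h : j < l.length, H.Adj l[i] l[j] with hA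
  set A' := (Finset.range (N - 1)).filter
    fun j => ∃ h : j + 1 < l.length, H.Adj l[i + 1] l[j + 1] with hA'
  have cA : (S.filter (H.Adj l[i])).card ≤ A.card + 1 := by
    have : S.filter (H.Adj l[i]) ⊆ insert v (A.image fun j => l.getD j v) := by
      intro y hy
      rw [Finset.mem_filter] at hy
      obtain ⟨j, hj, rfl⟩ := List.getElem_of_mem ((hl.mem_iff y).2 (by simpa using hy.1))
      rw [Finset.mem_insert, Finset.mem_image]
      by_cases hjN : j = N - 1
      · left
        have := hl.last
        rw [List.getLast?_eq_getElem?, List.getElem?_eq_getElem (by omega)] at this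
        simp only [Option.some.injEq] at this
        rw [← this]; congr 1; omega
      · right
        refine ⟨j, ?_, by simp [hj]⟩
        rw [hA, Finset.mem_filter, Finset.mem_range]
        exact ⟨by omega, hj, hy.2⟩
    calc _ ≤ _ := Finset.card_le_card this
      _ ≤ _ := Finset.card_insert_le _ _
      _ ≤ _ := by gcongr; exact Finset.card_image_le
  have cA' : (S.filter (H.Adj l[i + 1])).card ≤ A'.card + 1 := by
    have : S.filter (H.Adj l[i + 1]) ⊆ insert u (A'.image fun j => l.getD (j + 1) v) := by
      intro y hy
      rw [Finset.mem_filter] at hy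
      obtain ⟨j, hj, rfl⟩ := List.getElem_of_mem ((hl.mem_iff y).2 (by simpa using hy.1))
      rw [Finset.mem_insert, Finset.mem_image]
      rcases Nat.eq_zero_or_pos j with hj0 | hj0
      · left
        have := hl.head
        rw [List.head?_eq_getElem?, List.getElem?_eq_getElem (by omega)] at this
        simp only [Option.some.injEq] at this
        rw [← this]; congr 1
      · right
        obtain ⟨k, rfl⟩ : ∃ k, j = k + 1 := ⟨j - 1, by omega⟩
        refine ⟨k, ?_, by simp [hj]⟩
        rw [hA', Finset.mem_filter, Finset.mem_range]
        exact ⟨by omega, hj, hy.2⟩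
    calc _ ≤ _ := Finset.card_le_card this
      _ ≤ _ := Finset.card_insert_le _ _
      _ ≤ _ := by gcongr; exact Finset.card_image_le
  -- The sizes add up to at least `N + 1 - 2`, but neither set contains `i`, so the union has at
  -- most `N - 2` elements.
  have hne : (A ∩ A').Nonempty := by
    rw [← Finset.card_pos]
    have h1 := Finset.card_union_add_card_inter A A'
    have h2 : (A ∪ A').card ≤ N - 2 := by
      have : A ∪ A' ⊆ (Finset.range (N - 1)).erase i := by
        intro j hj
        rw [Finset.mem_union, hA, hA', Finset.mem_filter, Finset.mem_filter] at hj
        rw [Finset.mem_erase]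
        rcases hj with ⟨h1, h2, h3⟩ | ⟨h1, h2, h3⟩
        · exact ⟨by rintro rfl; exact H.loopless.irrefl _ h3, h1⟩
        · exact ⟨by rintro rfl; exact H.loopless.irrefl _ h3, h1⟩
      refine (Finset.card_le_card this).trans ?_
      rw [Finset.card_erase_of_mem (by rw [Finset.mem_range]; omega), Finset.card_range]
      omega
    have h3 := hdeg _ (hmemS i (by omega))
    have h4 := hdeg _ (hmemS (i + 1) (by omega))
    omega
  obtain ⟨j, hj⟩ := hne
  rw [Finset.mem_inter, hA, hA', Finset.mem_filter, Finset.mem_filter] at hj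
  obtain ⟨⟨hj1, hj2, hj3⟩, -, hj4, hj5⟩ := hj
  have hij : j ≠ i := by rintro rfl; exact H.loopless.irrefl _ hj3
  rcases lt_or_gt_of_ne hij with h | h
  · obtain ⟨l', hl', hlt⟩ := exists_lt_defect hl h hi hj3.symm hj5.symm (Or.inr hbad)
    exact absurd (hmin l' hl') (by omega)
  · obtain ⟨l', hl', hlt⟩ := exists_lt_defect hl h hj4 hj3 hj5 (Or.inl hbad)
    exact absurd (hmin l' hl') (by omega)

/-- The edge between the ends closes the path. With three or more vertices it is not already on the
path, since a path containing the edge between its ends has length one. -/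
lemma isHamiltonian_of_hasPathOn [Fintype V] [DecidableEq V] {H : SimpleGraph V} {u v : V}
    (h : HasPathOn H Set.univ u v) (huv : H.Adj u v) (hcard : 3 ≤ Fintype.card V) :
    H.IsHamiltonian := by
  intro _
  obtain ⟨l, hl, hc⟩ := h
  have hne : l ≠ [] := by rintro rfl; simpa using hl.head
  have hlen : l.length = Fintype.card V := by
    rw [← List.toFinset_card_of_nodup hl.nodup, ← Finset.card_univ]
    congr 1; ext x; simp [hl.mem_iff]
  have h1 : l.head hne = u := by
    have := hl.head; rw [List.head?_eq_some_head hne] at this; simpa using this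
  have h2 : l.getLast hne = v := by
    have := hl.last; rw [List.getLast?_eq_some_getLast hne] at this; simpa using this
  obtain ⟨p, hp⟩ : ∃ p : H.Walk u v, p.support = l := by
    refine ⟨(SimpleGraph.Walk.ofSupport l hne hc).copy h1 h2, ?_⟩
    simp [SimpleGraph.Walk.support_ofSupport]
  have hpath : p.IsPath := by
    rw [SimpleGraph.Walk.isPath_def, hp]; exact hl.nodup
  have hplen : p.length + 1 = Fintype.card V := by
    rw [← SimpleGraph.Walk.length_support, hp, hlen]
  refine ⟨v, SimpleGraph.Walk.cons huv.symm p, ?_⟩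
  rw [SimpleGraph.Walk.isHamiltonianCycle_isCycle_and_isHamiltonian_tail]
  refine ⟨?_, ?_⟩
  · rw [SimpleGraph.Walk.cons_isCycle_iff]
    refine ⟨hpath, fun he => ?_⟩
    have := hpath.length_eq_one_of_mem_edges (Sym2.eq_swap ▸ he)
    omega
  · rw [SimpleGraph.Walk.IsPath.isHamiltonian_iff]
    · intro w; simp [hp, hl.mem_iff]
    · simpa using hpath

end HamiltonPaths

/-! ### Chains of linked dense cells -/

section CliqueChains

variable {V ι : Type*}

lemma IsListing.append {S T : Set V} {u v x y : V} {l₁ l₂ : List V} (h₁ : IsListing S u v l₁)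
    (h₂ : IsListing T x y l₂) (hST : Disjoint S T) : IsListing (S ∪ T) u y (l₁ ++ l₂) := by
  refine ⟨?_, ?_, ?_, ?_⟩
  · rw [List.nodup_append]
    refine ⟨h₁.nodup, h₂.nodup, fun a ha b hb hab => ?_⟩
    exact Set.disjoint_left.1 hST ((h₁.mem_iff a).1 ha) (hab ▸ (h₂.mem_iff b).1 hb)
  · intro z
    rw [List.mem_append, h₁.mem_iff, h₂.mem_iff, Set.mem_union]
  · rw [List.head?_append, h₁.head]; rfl
  · rw [List.getLast?_append, h₂.last]; rfl

lemma HasPathOn.append {H : SimpleGraph V} {S T : Set V} {u v x y : V} (h₁ : HasPathOn H S u v)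
    (h₂ : HasPathOn H T x y) (hST : Disjoint S T) (hvx : H.Adj v x) :
    HasPathOn H (S ∪ T) u y := by
  obtain ⟨l₁, hl₁, hc₁⟩ := h₁
  obtain ⟨l₂, hl₂, hc₂⟩ := h₂
  refine ⟨l₁ ++ l₂, hl₁.append hl₂ hST, hc₁.append hc₂ ?_⟩
  rw [hl₁.last, hl₂.head]
  simpa using hvx

lemma hasPathOn_triple {H : SimpleGraph V} {u w a : V} (huw : H.Adj u w) (hwa : H.Adj w a)
    (hua : u ≠ a) : HasPathOn H {u, w, a} u a := by
  refine ⟨[u, w, a], ⟨?_, ?_, rfl, rfl⟩, ?_⟩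
  · simp [huw.ne, hwa.ne, hua]
  · simp
  · simp [huw, hwa]

open Classical in
/-- A cell whose induced subgraph misses at most `D` further edges at each vertex. -/
structure IsDenseCell (H : SimpleGraph V) (D : ℕ) (B : Finset V) : Prop where
  card_le : ∀ x ∈ B, (B.filter fun y => ¬ H.Adj x y).card ≤ D + 1
  le_card : 2 * D + 8 ≤ B.card

open Classical in
/-- Two cells joined by many edges. -/
def AreLinked (H : SimpleGraph V) (B B' : Finset V) : Prop :=
  ∃ P ⊆ B', 2 ≤ P.card ∧ ∀ x ∈ P, 4 ≤ (B.filter (H.Adj x)).card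

open Classical in
-- At least `2 * D + 5` vertices survive, each with at most `D + 1` non-neighbours (itself
-- included), so degrees still exceed half.
lemma IsDenseCell.hasPathOn_sdiff {H : SimpleGraph V} {D : ℕ} {B : Finset V}
    (hB : IsDenseCell H D B) {T : Finset V} (hT : T.card ≤ 3) {u v : V}
    (hu : u ∈ B \ T) (hv : v ∈ B \ T) (huv : u ≠ v) : HasPathOn H (B \ T : Finset V) u v := by
  refine hasPathOn_of_degree H (B \ T) (fun x hx => ?_) hu hv huv
  have h1 := hB.card_le x (Finset.mem_sdiff.1 hx).1
  have h2 := Finset.card_filter_add_card_filter_not (s := B \ T) (H.Adj x)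
  have h3 : ((B \ T).filter fun y => ¬ H.Adj x y).card ≤ D + 1 :=
    (Finset.card_le_card (Finset.filter_subset_filter _ Finset.sdiff_subset)).trans h1
  have h4 := Finset.le_card_sdiff T B
  have h5 := hB.le_card
  omega

open Classical in
lemma IsDenseCell.exists_common {H : SimpleGraph V} {D : ℕ} {B : Finset V}
    (hB : IsDenseCell H D B) {u a : V} (hu : u ∈ B) (ha : a ∈ B) {T : Finset V}
    (hT : T.card ≤ 3) : ∃ w ∈ B, w ∉ T ∧ H.Adj u w ∧ H.Adj a w := by
  by_contra! hno
  have : B ⊆ T ∪ ((B.filter fun y => ¬ H.Adj u y) ∪ B.filter fun y => ¬ H.Adj a y) := by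
    intro w hw
    simp only [Finset.mem_union, Finset.mem_filter, hw, true_and]
    by_contra! h
    exact hno w hw h.1 h.2.1 h.2.2
  have h1 := Finset.card_le_card this
  have h2 := Finset.card_union_le T
    ((B.filter fun y => ¬ H.Adj u y) ∪ B.filter fun y => ¬ H.Adj a y)
  have h3 := Finset.card_union_le (B.filter fun y => ¬ H.Adj u y) (B.filter fun y => ¬ H.Adj a y)
  have h4 := hB.card_le u hu
  have h5 := hB.card_le a ha
  have h6 := hB.le_card
  omega

open Classical in
lemma exists_mem_filter_not_mem {B T : Finset V} {p : V → Prop} (h : T.card < (B.filter p).card) :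
    ∃ x ∈ B, p x ∧ x ∉ T := by
  obtain ⟨x, hx, hxT⟩ := Finset.exists_mem_notMem_of_card_lt_card h
  rw [Finset.mem_filter] at hx
  exact ⟨x, hx.1, hx.2, hxT⟩

/-- A chain of pairwise disjoint dense cells, consecutive ones linked, is Hamilton-connected
within its first cell. -/
lemma hasPathOn_chain {H : SimpleGraph V} {D : ℕ} {B : ι → Finset V}
    (hB : ∀ q, IsDenseCell H D (B q)) (hdisj : Pairwise fun q q' => Disjoint (B q) (B q')) :
    ∀ (cs : List ι) (q : ι), (q :: cs).Nodup →
      (q :: cs).IsChain (fun q q' => AreLinked H (B q) (B q')) →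
      ∀ u ∈ B q, ∀ v ∈ B q, u ≠ v → HasPathOn H {x | ∃ p ∈ q :: cs, x ∈ B p} u v
  | [], q, _, _, u, hu, v, hv, huv => by
      classical
      have := (hB q).hasPathOn_sdiff (T := ∅) (by simp) (by simpa using hu) (by simpa using hv) huv
      convert this using 1
      ext x; simp
  | q' :: cs, q, hnd, hch, u, hu, v, hv, huv => by
      classical
      obtain ⟨P, hPB, hP2, hP⟩ := (List.isChain_cons_cons.1 hch).1
      obtain ⟨x, hx, y, hy, hxy⟩ := Finset.one_lt_card.1 hP2
      have ih := hasPathOn_chain hB hdisj cs q' (List.nodup_cons.1 hnd).2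
        (List.isChain_cons_cons.1 hch).2 x (hPB hx) y (hPB hy) hxy
      -- The path is `u, w, a`, then from `x` to `y` through all later cells, then from `b` to `v`
      -- through the rest of this cell. Choosing `b` outside `{u, v, a}` is what needs four
      -- neighbours in `AreLinked`.
      obtain ⟨a, haB, hxa, ha⟩ := exists_mem_filter_not_mem (B := B q) (T := {u, v})
        (p := H.Adj x) (lt_of_le_of_lt Finset.card_le_two (lt_of_lt_of_le (by norm_num) (hP x hx)))
      obtain ⟨b, hbB, hyb, hb⟩ := exists_mem_filter_not_mem (B := B q) (T := {u, v, a})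
        (p := H.Adj y) (lt_of_le_of_lt Finset.card_le_three
          (lt_of_lt_of_le (by norm_num) (hP y hy)))
      obtain ⟨w, hwB, hw, huw, haw⟩ := (hB q).exists_common hu haB (T := {v, b})
        (Finset.card_le_two.trans (by norm_num))
      simp only [Finset.mem_insert, Finset.mem_singleton, not_or] at ha hb hw
      have h1 := hasPathOn_triple huw haw.symm (Ne.symm ha.1)
      have h2 := (hB q).hasPathOn_sdiff (T := {u, w, a}) Finset.card_le_three (u := b) (v := v)
        (by simp [hbB, hb, Ne.symm hw.2]) (by simp [hv, huv.symm, Ne.symm hw.1, Ne.symm ha.2]) hb.2.1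
      have hqd : ∀ p ∈ q' :: cs, Disjoint (B q) (B p) := fun p hp =>
        hdisj (by rintro rfl; exact (List.nodup_cons.1 hnd).1 hp)
      have htri : ∀ z ∈ ({u, w, a} : Set V), z ∈ B q := by
        rintro z (rfl | rfl | rfl) <;> assumption
      have h3 := h1.append ih (Set.disjoint_left.2 fun z hz ⟨p, hp, hzp⟩ =>
        Finset.disjoint_left.1 (hqd p hp) (htri z hz) hzp) hxa.symm
      have h4 := h3.append h2 (Set.disjoint_left.2 fun z hz hz' => by
        rw [Finset.mem_coe, Finset.mem_sdiff] at hz'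
        rcases hz with hz | ⟨p, hp, hzp⟩
        · exact hz'.2 (by simpa using hz)
        · exact Finset.disjoint_left.1 (hqd p hp) hz'.1 hzp) hyb
      convert h4 using 1
      ext z
      simp only [Set.mem_ofPred_eq, Set.mem_union, Finset.mem_coe, Finset.mem_sdiff,
        List.mem_cons (a := _) (b := q), exists_eq_or_imp]
      have := htri z
      simp only [Set.mem_insert_iff, Set.mem_singleton_iff, Finset.mem_insert,
        Finset.mem_singleton] at this ⊢
      by_cases hz : z = u ∨ z = w ∨ z = a
      · simp only [hz, this hz, true_or]
      · rw [or_comm, or_assoc, or_iff_right hz, and_iff_left hz, or_comm, or_comm (a := z ∈ B q)]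

/-- A graph whose vertex set is covered by a chain of linked dense cells is Hamiltonian. -/
lemma isHamiltonian_of_chain [Fintype V] [DecidableEq V] {H : SimpleGraph V} {D : ℕ} {B : ι → Finset V}
    (hB : ∀ q, IsDenseCell H D (B q)) (hdisj : Pairwise fun q q' => Disjoint (B q) (B q'))
    {cs : List ι} (hne : cs ≠ []) (hnd : cs.Nodup)
    (hch : cs.IsChain (fun q q' => AreLinked H (B q) (B q')))
    (hcov : ∀ x, ∃ p ∈ cs, x ∈ B p) : H.IsHamiltonian := by
  obtain ⟨q, cs, rfl⟩ := List.exists_cons_of_ne_nil hne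
  have h8 := (hB q).le_card
  obtain ⟨u, hu⟩ : (B q).Nonempty := Finset.card_pos.1 (by omega)
  obtain ⟨v, hv, -, huv, -⟩ := (hB q).exists_common hu hu (T := ∅) (by simp)
  have h := hasPathOn_chain hB hdisj cs q hnd hch u hu v hv huv.ne
  refine isHamiltonian_of_hasPathOn (u := u) (v := v) ?_ huv ?_
  · convert h using 1
    ext x; simpa using hcov x
  · have := Finset.card_le_univ (B q); omega

end CliqueChains

/-! ### A snake through the grid -/

section Snake

/-- A list of the lattice points of a box, in which consecutive points are neighbours. -/
lemma exists_snake (L : ℕ) (hL : 0 < L) : ∀ d : ℕ, ∃ l : List (Fin d → Fin L),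
    l ≠ [] ∧ l.Nodup ∧ (∀ p, p ∈ l) ∧ l.IsChain fun p q => ∃ j,
      (∀ i, i ≠ j → p i = q i) ∧ ((p j : ℕ) + 1 = q j ∨ (q j : ℕ) + 1 = p j)
  | 0 => ⟨[Fin.elim0], by simp, by simp, fun p => by simp; exact Subsingleton.elim _ _, by simp⟩
  | d + 1 => by
      obtain ⟨l, hne, hnd, hmem, hch⟩ := exists_snake L hL d
      set R : (Fin (d + 1) → Fin L) → (Fin (d + 1) → Fin L) → Prop := fun p q => ∃ j,
        (∀ i, i ≠ j → p i = q i) ∧ ((p j : ℕ) + 1 = q j ∨ (q j : ℕ) + 1 = p j) with hR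
      have hrow : ∀ (a : Fin L) (l' : List (Fin d → Fin L)), (l'.IsChain fun p q => ∃ j,
          (∀ i, i ≠ j → p i = q i) ∧ ((p j : ℕ) + 1 = q j ∨ (q j : ℕ) + 1 = p j)) →
          (l'.map (Fin.cons a : _ → Fin (d + 1) → Fin L)).IsChain R := by
        intro a l' h
        rw [List.isChain_map]
        refine h.imp ?_
        rintro p q ⟨j, h1, h2⟩
        refine ⟨j.succ, fun i hi => ?_, by simpa using h2⟩
        refine Fin.cases (by simp) (fun i hi => ?_) i hi
        simpa using h1 i (fun h => hi (by rw [h]))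
      -- Fill the layers one by one, running alternately along `l` and its reverse. The invariant
      -- records that the last point lies over an end of `l`, so the next layer can start directly
      -- above it.
      suffices h : ∀ k, 0 < k → k ≤ L → ∃ l' : List (Fin (d + 1) → Fin L), l' ≠ [] ∧ l'.Nodup ∧
          (∀ p, p ∈ l' ↔ (p 0 : ℕ) < k) ∧ l'.IsChain R ∧
          ∃ (a : Fin L) (p : Fin d → Fin L), (a : ℕ) + 1 = k ∧
            l'.getLast? = some (Fin.cons a p : Fin (d + 1) → Fin L) ∧
            (l.head? = some p ∨ l.reverse.head? = some p) by
        obtain ⟨l', h1, h2, h3, h4, -⟩ := h L hL le_rfl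
        exact ⟨l', h1, h2, fun p => (h3 p).2 (p 0).2, h4⟩
      have hrev : l.reverse.IsChain fun p q => ∃ j,
          (∀ i, i ≠ j → p i = q i) ∧ ((p j : ℕ) + 1 = q j ∨ (q j : ℕ) + 1 = p j) := by
        rw [List.isChain_reverse]
        refine hch.imp ?_
        rintro p q ⟨j, h1, h2⟩
        exact ⟨j, fun i hi => (h1 i hi).symm, h2.symm⟩
      intro k hk
      induction k, hk using Nat.le_induction with
      | base =>
        intro _
        refine ⟨l.map (Fin.cons (⟨0, hL⟩ : Fin L) : _ → Fin (d + 1) → Fin L), by simpa using hne,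
          hnd.map (Fin.cons_right_injective _), fun p => ?_, hrow _ _ hch, ⟨0, hL⟩,
          l.getLast hne, rfl, ?_, Or.inr ?_⟩
        · rw [List.mem_map]
          constructor
          · rintro ⟨p', -, rfl⟩; simp
          · intro h
            refine ⟨Fin.tail p, hmem _, ?_⟩
            rw [← Fin.cons_self_tail p]
            congr 1
            ext; simp at h ⊢; omega
        · rw [List.getLast?_map, List.getLast?_eq_some_getLast hne]; rfl
        · rw [List.head?_reverse, List.getLast?_eq_some_getLast hne]
      | succ k hk ih =>
        intro hkL
        obtain ⟨l', h1, h2, h3, h4, a, p, h5, h6, h7⟩ := ih (by omega)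
        obtain ⟨m, hm1, hm2, hm3, hm4, hm5, p', hm6, hm7⟩ : ∃ m : List (Fin d → Fin L), m.Nodup ∧
            (∀ p, p ∈ m) ∧ (m.IsChain fun p q => ∃ j,
            (∀ i, i ≠ j → p i = q i) ∧ ((p j : ℕ) + 1 = q j ∨ (q j : ℕ) + 1 = p j)) ∧
            m.head? = some p ∧ m ≠ [] ∧ ∃ p', m.getLast? = some p' ∧
              (l.head? = some p' ∨ l.reverse.head? = some p') := by
          rcases h7 with h7 | h7
          · refine ⟨l, hnd, hmem, hch, h7, hne, l.getLast hne,
              List.getLast?_eq_some_getLast hne, Or.inr ?_⟩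
            rw [List.head?_reverse, List.getLast?_eq_some_getLast hne]
          · refine ⟨l.reverse, List.nodup_reverse.2 hnd, fun p => by simpa using hmem p, hrev, h7,
              by simpa using hne, l.head hne, ?_, Or.inl (List.head?_eq_some_head hne)⟩
            rw [List.getLast?_reverse, List.head?_eq_some_head hne]
        set b : Fin L := ⟨k, by omega⟩ with hb
        refine ⟨l' ++ m.map (Fin.cons b : _ → Fin (d + 1) → Fin L), by simp [h1], ?_, ?_, ?_,
          b, p', rfl, ?_, hm7⟩
        · rw [List.nodup_append]
          refine ⟨h2, hm1.map (Fin.cons_right_injective _), fun x hx y hy hxy => ?_⟩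
          rw [List.mem_map] at hy
          obtain ⟨p', -, rfl⟩ := hy
          rw [h3, hxy] at hx
          simp [hb] at hx
        · intro x
          rw [List.mem_append, h3, List.mem_map, Nat.lt_succ_iff_lt_or_eq]
          refine or_congr_right ⟨?_, fun h => ⟨Fin.tail x, hm2 _, ?_⟩⟩
          · rintro ⟨p', -, rfl⟩; simp [hb]
          · rw [← Fin.cons_self_tail x]
            congr 1
            ext; simp [hb, h]
        · refine h4.append (hrow _ _ hm3) ?_
          rw [h6, List.head?_map, hm4]
          simp only [Option.mem_def, Option.some.injEq, Option.map_some, forall_eq']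
          refine ⟨0, fun i hi => ?_, Or.inl (by simp [hb, h5])⟩
          exact Fin.cases (fun h => absurd rfl h) (fun i _ => by simp) i hi
        · rw [List.getLast?_append, List.getLast?_map, hm6]; rfl

end Snake

/-! ### Binomial tail bounds -/

section Chernoff

variable {E : Type*} [MeasurableSpace E] (μ : Measure E) [IsProbabilityMeasure μ]

/-- The number of coordinates of `x` that lie in `S`. -/
noncomputable def countIn {ι : Type*} [Fintype ι] (S : Set E) (x : ι → E) : ℝ :=
  ∑ i, S.indicator (fun _ => (1 : ℝ)) (x i)

lemma measurable_countIn {ι : Type*} [Fintype ι] {S : Set E} (hS : MeasurableSet S) :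
    Measurable (countIn S : (ι → E) → ℝ) :=
  Finset.measurable_sum _ fun i _ =>
    (measurable_const.indicator hS).comp (measurable_pi_apply i)

variable (n : ℕ) {S : Set E}

/-- The exponential factors over independent coordinates, and each factor is `1 + (exp t - 1)` times
an indicator. -/
lemma mgf_countIn (hS : MeasurableSet S) (t : ℝ) :
    ProbabilityTheory.mgf (countIn S) (Measure.pi fun _ : Fin n => μ) t =
      (1 + (Real.exp t - 1) * μ.real S) ^ n := by
  have h1 : ∀ x : Fin n → E, Real.exp (t * countIn S x) =
      ∏ i, (1 + S.indicator (fun _ => Real.exp t - 1) (x i)) := by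
    intro x
    rw [countIn, Finset.mul_sum, Real.exp_sum]
    refine Finset.prod_congr rfl fun i _ => ?_
    by_cases h : x i ∈ S <;> simp [h]
  unfold ProbabilityTheory.mgf
  simp_rw [h1]
  rw [integral_fintype_prod_eq_pow (fun y => 1 + S.indicator (fun _ => Real.exp t - 1) y),
    Fintype.card_fin, integral_add (integrable_const _) ((integrable_const _).indicator hS),
    integral_indicator_const _ hS]
  simp [mul_comm]

lemma integrable_exp_countIn (hS : MeasurableSet S) (t : ℝ) :
    Integrable (fun x : Fin n → E => Real.exp (t * countIn S x))
      (Measure.pi fun _ : Fin n => μ) := by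
  refine Integrable.of_bound (C := Real.exp (|t| * n))
    ((Real.measurable_exp.comp ((measurable_countIn hS).const_mul t)).aestronglyMeasurable)
    (Eventually.of_forall fun x => ?_)
  rw [Real.norm_eq_abs, Real.abs_exp]
  refine Real.exp_le_exp.2 ((le_abs_self _).trans ?_)
  rw [abs_mul]
  refine mul_le_mul_of_nonneg_left ?_ (abs_nonneg t)
  refine (Finset.abs_sum_le_sum_abs _ _).trans ?_
  refine (Finset.sum_le_sum (g := fun _ => (1 : ℝ)) fun i _ => ?_).trans (by simp)
  by_cases h : x i ∈ S <;> simp [h]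

lemma exp_sub_one_le_sq {t : ℝ} (ht : |t| ≤ 1) : Real.exp t - 1 ≤ t + t ^ 2 := by
  have := (abs_le.1 (Real.abs_exp_sub_one_sub_id_le ht)).2
  linarith

lemma mgf_countIn_le (hS : MeasurableSet S) (t : ℝ) :
    ProbabilityTheory.mgf (countIn S) (Measure.pi fun _ : Fin n => μ) t ≤
      Real.exp ((Real.exp t - 1) * (n * μ.real S)) := by
  rw [mgf_countIn μ n hS t]
  have h0 : 0 ≤ 1 + (Real.exp t - 1) * μ.real S := by
    have h1 : μ.real S ≤ 1 := measureReal_le_one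
    have h2 : 0 ≤ μ.real S := measureReal_nonneg
    have := mul_nonneg (Real.exp_pos t).le h2
    linarith
  calc _ ≤ (Real.exp ((Real.exp t - 1) * μ.real S)) ^ n := by
        refine pow_le_pow_left₀ h0 ?_ n
        rw [add_comm]; exact Real.add_one_le_exp _
    _ = _ := by rw [← Real.exp_nat_mul]; ring_nf

/-- Upper tail of a binomial random variable. -/
lemma countIn_upper_tail (hS : MeasurableSet S) {m δ : ℝ} (hδ : 0 ≤ δ) (hδ1 : δ ≤ 1)
    (hm : n * μ.real S ≤ m) :
    (Measure.pi fun _ : Fin n => μ).real {x | (1 + δ) * m ≤ countIn S x} ≤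
      Real.exp (-(δ ^ 2 / 4 * m)) := by
  have hm0 : 0 ≤ m := le_trans (by positivity) hm
  -- With `t = δ / 2` and `exp t - 1 ≤ t + t ^ 2`, the exponent is at most `(-t * (1 + δ) + t + t ^
  -- 2) * m = -(δ ^ 2 / 4) * m`.
  refine (ProbabilityTheory.measure_ge_le_exp_mul_mgf _ (t := δ / 2) (by positivity)
    (integrable_exp_countIn μ n hS _)).trans ?_
  refine (mul_le_mul_of_nonneg_left (mgf_countIn_le μ n hS _) (Real.exp_pos _).le).trans ?_
  rw [← Real.exp_add]
  refine Real.exp_le_exp.2 ?_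
  have h1 := exp_sub_one_le_sq (t := δ / 2) (by rw [abs_of_nonneg (by positivity)]; linarith)
  have h2 : 0 ≤ Real.exp (δ / 2) - 1 := by
    have := Real.add_one_le_exp (δ / 2); linarith
  have h3 := mul_le_mul h1 hm (by positivity) (by positivity)
  linarith

/-- Lower tail of a binomial random variable. -/
lemma countIn_lower_tail (hS : MeasurableSet S) {m δ : ℝ} (hδ : 0 ≤ δ) (hδ1 : δ ≤ 1)
    (hm0 : 0 ≤ m) (hm : m ≤ n * μ.real S) :
    (Measure.pi fun _ : Fin n => μ).real {x | countIn S x ≤ (1 - δ) * m} ≤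
      Real.exp (-(δ ^ 2 / 4 * m)) := by
  refine (ProbabilityTheory.measure_le_le_exp_mul_mgf _ (t := -(δ / 2)) (by linarith)
    (integrable_exp_countIn μ n hS _)).trans ?_
  refine (mul_le_mul_of_nonneg_left (mgf_countIn_le μ n hS _) (Real.exp_pos _).le).trans ?_
  rw [← Real.exp_add]
  refine Real.exp_le_exp.2 ?_
  have h1 := exp_sub_one_le_sq (t := -(δ / 2))
    (by rw [abs_neg, abs_of_nonneg (by positivity)]; linarith)
  have h2 : Real.exp (-(δ / 2)) - 1 ≤ 0 := by
    have := Real.exp_le_one_iff.2 (show -(δ / 2) ≤ 0 by linarith); linarith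
  have h3 := mul_le_mul_of_nonpos_left hm h2
  have h4 := mul_le_mul_of_nonneg_right h1 hm0
  linarith

/-- Upper tail of the number of points that are related to a given one. -/
lemma relation_upper_tail {T : Set (E × E)} (hT : MeasurableSet T) {m δ : ℝ} (hδ : 0 ≤ δ)
    (hδ1 : δ ≤ 1) (hm : ∀ y, n * μ.real (Prod.mk y ⁻¹' T) ≤ m) (v : Fin (n + 1)) :
    (Measure.pi fun _ : Fin (n + 1) => μ)
      {x | (1 + δ) * m ≤ countIn (Prod.mk (x v) ⁻¹' T) fun j => x (v.succAbove j)} ≤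
      ENNReal.ofReal (Real.exp (-(δ ^ 2 / 4 * m))) := by
  -- Split off coordinate `v`: once it is fixed, the relevant set is deterministic and the other
  -- points are independent of it, so Fubini reduces to the binomial bound.
  have hmp := measurePreserving_piFinSuccAbove (fun _ : Fin (n + 1) => μ) v
  set W : Set (E × (Fin n → E)) := {z | (1 + δ) * m ≤ countIn (Prod.mk z.1 ⁻¹' T) z.2} with hW
  have hWm : MeasurableSet W := by
    refine measurableSet_le measurable_const (Finset.measurable_sum _ fun i _ => ?_)
    have : Measurable fun z : E × (Fin n → E) => (z.1, z.2 i) :=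
      measurable_fst.prodMk ((measurable_pi_apply i).comp measurable_snd)
    exact (measurable_const.indicator hT).comp this
  have : {x : Fin (n + 1) → E | (1 + δ) * m ≤
      countIn (Prod.mk (x v) ⁻¹' T) fun j => x (v.succAbove j)} =
      MeasurableEquiv.piFinSuccAbove (fun _ => E) v ⁻¹' W := rfl
  rw [this, hmp.measure_preimage hWm.nullMeasurableSet, Measure.prod_apply hWm]
  refine (lintegral_mono (g := fun _ => ENNReal.ofReal (Real.exp (-(δ ^ 2 / 4 * m))))
    fun y => ?_).trans (by simp)
  have h := countIn_upper_tail μ n (measurable_prodMk_left (x := y) hT) hδ hδ1 (hm y)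
  rw [← ofReal_measureReal]
  exact ENNReal.ofReal_le_ofReal h

end Chernoff

/-! ### Grid cubes, their halves, and the deterministic criterion -/

section Grid

variable {d : ℕ}

/-- A half-open box. -/
def boxIco (a b : Fin d → ℝ) : Set (EuclideanSpace ℝ (Fin d)) :=
  {x | ∀ i, x i ∈ Set.Ico (a i) (b i)}

lemma boxIco_eq_preimage (a b : Fin d → ℝ) : boxIco a b =
    (WithLp.ofLp : EuclideanSpace ℝ (Fin d) → Fin d → ℝ) ⁻¹'
      (Set.univ.pi fun i => Set.Ico (a i) (b i)) := by
  ext x; simp [boxIco]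

lemma measurableSet_boxIco (a b : Fin d → ℝ) : MeasurableSet (boxIco a b) := by
  rw [boxIco_eq_preimage]
  exact (PiLp.volume_preserving_ofLp (Fin d)).measurable
    (MeasurableSet.univ_pi fun _ => measurableSet_Ico)

lemma volume_boxIco (a b : Fin d → ℝ) :
    volume (boxIco a b) = ∏ i, ENNReal.ofReal (b i - a i) := by
  rw [boxIco_eq_preimage, (PiLp.volume_preserving_ofLp (Fin d)).measure_preimage
    (MeasurableSet.univ_pi fun _ => measurableSet_Ico).nullMeasurableSet, volume_pi_pi]
  simp

lemma measurableSet_unitCube (d : ℕ) : MeasurableSet (unitCube d) := by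
  have h : unitCube d = (WithLp.ofLp : EuclideanSpace ℝ (Fin d) → Fin d → ℝ) ⁻¹'
      (Set.univ.pi fun _ => Set.Icc (0 : ℝ) 1) := by
    ext x; simp [unitCube, Pi.le_def, forall_and]
  rw [h]
  exact (PiLp.volume_preserving_ofLp (Fin d)).measurable
    (MeasurableSet.univ_pi fun _ => measurableSet_Icc)

lemma uniformCube_apply (S : Set (EuclideanSpace ℝ (Fin d))) :
    uniformCube d S = volume (unitCube d ∩ S) := by
  rw [uniformCube, ProbabilityTheory.cond_apply (measurableSet_unitCube d), volume_unitCube]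
  simp

lemma ae_mem_unitCube (d n : ℕ) : ∀ᵐ x ∂uniformPoints d n, ∀ i, x i ∈ unitCube d := by
  have h : ∀ᵐ y ∂uniformCube d, y ∈ unitCube d := by
    rw [ae_iff, uniformCube_apply]
    convert measure_empty (μ := volume) using 2
    ext y; simp
  exact ae_all_iff.2 fun i =>
    (Measure.quasiMeasurePreserving_eval (μ := fun _ : Fin n => uniformCube d) i).ae h

lemma uniformCube_closedBall_le (y : EuclideanSpace ℝ (Fin d)) {r : ℝ} (hr : 0 ≤ r) :
    (uniformCube d).real {z | ‖y - z‖ ≤ r} ≤ unitBallVolume d * r ^ d := by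
  have h : {z | ‖y - z‖ ≤ r} = Metric.closedBall y r := by
    ext z; simp [dist_eq_norm, norm_sub_rev]
  have hfin : volume (Metric.ball (0 : EuclideanSpace ℝ (Fin d)) 1) ≠ ⊤ :=
    measure_ball_lt_top.ne
  rw [measureReal_def, uniformCube_apply, h]
  refine (ENNReal.toReal_mono measure_closedBall_lt_top.ne
    (measure_mono Set.inter_subset_right)).trans_eq ?_
  rw [Measure.addHaar_closedBall _ _ hr, ENNReal.toReal_mul,
    ENNReal.toReal_ofReal (by positivity), unitBallVolume, finrank_euclideanSpace_fin, mul_comm]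

variable {L : ℕ}

/-- One of the two halves, in direction `j`, of the grid cube with index `q` and side `1 / L`. -/
def halfCell (q : Fin d → Fin L) (j : Fin d) (upper : Bool) : Set (EuclideanSpace ℝ (Fin d)) :=
  boxIco (fun i => ((q i : ℕ) + (if i = j ∧ upper = true then 1 / 2 else 0 : ℝ)) / L)
    (fun i => ((q i : ℕ) + (if i = j ∧ upper = false then 1 / 2 else 1 : ℝ)) / L)

lemma mem_halfCell (hL : 0 < L) {q : Fin d → Fin L} {j : Fin d} {upper : Bool}
    {x : EuclideanSpace ℝ (Fin d)} : x ∈ halfCell q j upper ↔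
      ∀ i, (q i : ℕ) + (if i = j ∧ upper = true then 1 / 2 else 0 : ℝ) ≤ L * x i ∧
        L * x i < (q i : ℕ) + (if i = j ∧ upper = false then 1 / 2 else 1 : ℝ) := by
  have hL' : (0 : ℝ) < L := by exact_mod_cast hL
  refine forall_congr' fun i => ?_
  rw [Set.mem_Ico, div_le_iff₀ hL', lt_div_iff₀ hL', mul_comm]

lemma uniformCube_halfCell (hL : 0 < L) (q : Fin d → Fin L) (j : Fin d) (upper : Bool) :
    (uniformCube d).real (halfCell q j upper) = 1 / (2 * (L : ℝ) ^ d) := by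
  have hL' : (0 : ℝ) < L := by exact_mod_cast hL
  have hsub : halfCell q j upper ⊆ unitCube d := by
    intro x hx i
    have h := (mem_halfCell hL).1 hx i
    have hq : ((q i : ℕ) : ℝ) + 1 ≤ L := by exact_mod_cast (q i).2
    have hq0 : (0 : ℝ) ≤ (q i : ℕ) := Nat.cast_nonneg _
    have h1 : (0 : ℝ) ≤ if i = j ∧ upper = true then 1 / 2 else 0 := by split_ifs <;> norm_num
    have h2 : (if i = j ∧ upper = false then 1 / 2 else 1 : ℝ) ≤ 1 := by split_ifs <;> norm_num
    constructor
    · by_contra! hneg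
      have := mul_neg_of_pos_of_neg hL' hneg
      linarith [h.1]
    · by_contra! hgt
      have := mul_lt_mul_of_pos_left hgt hL'
      linarith [h.2]
  rw [measureReal_def, uniformCube_apply, Set.inter_eq_right.2 hsub, halfCell, volume_boxIco,
    ENNReal.toReal_prod]
  have : ∀ i ∈ Finset.univ, (ENNReal.ofReal
      (((q i : ℕ) + (if i = j ∧ upper = false then 1 / 2 else 1 : ℝ)) / L -
        ((q i : ℕ) + (if i = j ∧ upper = true then 1 / 2 else 0 : ℝ)) / L)).toReal =
      (1 / L) * if i = j then 1 / 2 else 1 := by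
    intro i _
    rw [← sub_div, ENNReal.toReal_ofReal]
    · by_cases h : i = j <;> cases upper <;> simp [h] <;> ring
    · refine div_nonneg ?_ hL'.le
      by_cases h : i = j <;> cases upper <;> simp [h]; norm_num
  rw [Finset.prod_congr rfl this, Finset.prod_mul_distrib, Finset.prod_ite_eq']
  simp

/-- The index of the grid cube of side `1 / L` that contains a point of the unit cube. -/
noncomputable def cellOf (hL : 0 < L) (x : EuclideanSpace ℝ (Fin d)) : Fin d → Fin L :=
  -- The minimum puts points with a coordinate equal to `1` into the last cube.
  fun i => ⟨min ⌊L * x i⌋₊ (L - 1), by omega⟩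

lemma cellOf_le (hL : 0 < L) {x : EuclideanSpace ℝ (Fin d)} (hx : x ∈ unitCube d) (i : Fin d) :
    ((cellOf hL x i : ℕ) : ℝ) ≤ L * x i ∧ L * x i ≤ (cellOf hL x i : ℕ) + 1 := by
  have hL' : (0 : ℝ) < L := by exact_mod_cast hL
  have h0 : 0 ≤ L * x i := mul_nonneg hL'.le (hx i).1
  have h1 : L * x i ≤ L := by nlinarith [(hx i).2]
  have hc : (cellOf hL x i : ℕ) = min ⌊L * x i⌋₊ (L - 1) := rfl
  rw [hc]
  constructor
  · refine le_trans ?_ (Nat.floor_le h0)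
    exact_mod_cast min_le_left _ _
  · rcases min_choice ⌊L * x i⌋₊ (L - 1) with h | h <;> rw [h]
    · exact (Nat.lt_floor_add_one _).le
    · rw [Nat.cast_sub hL]; simpa using h1

lemma cellOf_eq_of_mem (hL : 0 < L) {q : Fin d → Fin L} {j : Fin d} {upper : Bool}
    {x : EuclideanSpace ℝ (Fin d)} (hx : x ∈ halfCell q j upper) : cellOf hL x = q := by
  funext i
  have h := (mem_halfCell hL).1 hx i
  have h1 : (0 : ℝ) ≤ if i = j ∧ upper = true then 1 / 2 else 0 := by split_ifs <;> norm_num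
  have h2 : (if i = j ∧ upper = false then 1 / 2 else 1 : ℝ) ≤ 1 := by split_ifs <;> norm_num
  have hf : ⌊L * x i⌋₊ = (q i : ℕ) := by
    rw [Nat.floor_eq_iff (le_trans (by positivity) h.1)]
    exact ⟨by linarith [h.1], by linarith [h.2]⟩
  ext
  change min ⌊L * x i⌋₊ (L - 1) = _
  rw [hf]
  have := (q i).2
  omega

/-- A box of side `1 / L` has diameter `√d / L`, which is at most `r`. -/
lemma norm_sub_le_of_coord (hL : 0 < L) {r : ℝ} (hr : Real.sqrt d ≤ r * L)
    {x y : EuclideanSpace ℝ (Fin d)} (h : ∀ i, |L * x i - L * y i| ≤ 1) : ‖x - y‖ ≤ r := by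
  have hL' : (0 : ℝ) < L := by exact_mod_cast hL
  have h1 : ‖(L : ℝ) • (x - y)‖ ≤ Real.sqrt d := by
    rw [EuclideanSpace.norm_eq]
    refine Real.sqrt_le_sqrt ?_
    refine (Finset.sum_le_sum (g := fun _ => (1 : ℝ)) fun i _ => ?_).trans (by simp)
    have : ((L : ℝ) • (x - y)) i = L * x i - L * y i := by simp [mul_sub]
    rw [this, Real.norm_eq_abs]
    exact pow_le_one₀ (abs_nonneg _) (h i)
  rw [norm_smul, Real.norm_of_nonneg hL'.le] at h1
  by_contra! hlt
  have := mul_lt_mul_of_pos_left hlt hL'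
  linarith

open Classical in
/-- If every half cube of the grid contains more than `D + 3` points, then deleting at most `D` edges
at each vertex of the geometric graph leaves a Hamiltonian graph. -/
lemma isHamiltonian_of_halfCell (hd : 1 ≤ d) (hL : 0 < L) {n : ℕ} {r : ℝ}
    (hr : Real.sqrt d ≤ r * L) {x : Fin n → EuclideanSpace ℝ (Fin d)}
    (hx : ∀ i, x i ∈ unitCube d) {D : ℕ}
    (hcount : ∀ (q : Fin d → Fin L) j upper,
      D + 4 ≤ (Finset.univ.filter fun i => x i ∈ halfCell q j upper).card)
    {H : SimpleGraph (Fin n)}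
    (hH : ∀ v, (Finset.univ.filter fun u => (geometricGraph r x).Adj v u ∧ ¬ H.Adj v u).card ≤ D) :
    H.IsHamiltonian := by
  obtain ⟨cs, hne, hnd, hmem, hch⟩ := exists_snake L hL d
  set B : (Fin d → Fin L) → Finset (Fin n) :=
    fun q => Finset.univ.filter fun i => cellOf hL (x i) = q with hBdef
  have hmemB : ∀ q i, i ∈ B q ↔ cellOf hL (x i) = q := fun q i => by simp [hBdef]
  have hhalf : ∀ q j upper, (Finset.univ.filter fun i => x i ∈ halfCell q j upper) ⊆ B q :=
    fun q j upper i hi => (hmemB q i).2 (cellOf_eq_of_mem hL (by simpa using hi))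
  have hlink : ∀ {q q' : Fin d → Fin L} {j upper upper'}, q ≠ q' →
      (∀ y ∈ halfCell q j upper, ∀ z ∈ halfCell q' j upper', ∀ i, |L * y i - L * z i| ≤ 1) →
      AreLinked H (B q) (B q') := by
    intro q q' j upper upper' hqq' hclose
    refine ⟨_, hhalf q' j upper', by linarith [hcount q' j upper'], fun u hu => ?_⟩
    have h1 : (Finset.univ.filter fun i => x i ∈ halfCell q j upper) ⊆
        ((B q).filter (H.Adj u)) ∪
          Finset.univ.filter fun w => (geometricGraph r x).Adj u w ∧ ¬ H.Adj u w := by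
      intro w hw
      have hwB := hhalf q j upper hw
      simp only [Finset.mem_union, Finset.mem_filter, Finset.mem_univ, true_and] at hu hw ⊢
      by_cases ha : H.Adj u w
      · exact Or.inl ⟨hwB, ha⟩
      · refine Or.inr ⟨⟨?_, ?_⟩, ha⟩
        · rintro rfl
          exact hqq' ((cellOf_eq_of_mem hL hw).symm.trans (cellOf_eq_of_mem hL hu))
        · rw [norm_sub_rev]
          exact norm_sub_le_of_coord hL hr (hclose _ hw _ hu)
    have h2 := (Finset.card_le_card h1).trans (Finset.card_union_le _ _)
    have h3 := hcount q j upper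
    have h4 := hH u
    omega
  -- The upper half of a cube and the lower half of the next one in direction `j` fit into one box
  -- of side `1 / L`.
  have hnext : ∀ {q q' : Fin d → Fin L} {j : Fin d}, (∀ i, i ≠ j → q i = q' i) →
      (q j : ℕ) + 1 = q' j → ∀ y ∈ halfCell q j true, ∀ z ∈ halfCell q' j false,
      ∀ i, |L * y i - L * z i| ≤ 1 := by
    intro q q' j hq hj y hy z hz i
    have h1 := (mem_halfCell hL).1 hy i
    have h2 := (mem_halfCell hL).1 hz i
    by_cases hi : i = j
    · subst hi
      have hj' : ((q i : ℕ) : ℝ) + 1 = (q' i : ℕ) := by exact_mod_cast hj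
      simp only [true_and, if_true, Bool.true_eq_false, Bool.false_eq_true, if_false] at h1 h2
      rw [abs_le]; constructor <;> linarith [h1.1, h1.2, h2.1, h2.2]
    · simp only [hi, false_and, if_false, hq i hi] at h1 h2
      rw [abs_le]; constructor <;> linarith [h1.1, h1.2, h2.1, h2.2]
  refine isHamiltonian_of_chain (D := D) (B := B) (fun q => ⟨fun u hu => ?_, ?_⟩) ?_ hne hnd ?_
    (fun i => ⟨_, hmem _, (hmemB _ i).2 rfl⟩)
  · have h1 : ((B q).filter fun w => ¬ H.Adj u w) ⊆
        {u} ∪ Finset.univ.filter fun w => (geometricGraph r x).Adj u w ∧ ¬ H.Adj u w := by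
      intro w hw
      rw [hmemB] at hu
      simp only [Finset.mem_union, Finset.mem_filter, Finset.mem_univ, true_and, hmemB,
        Finset.mem_singleton] at hw ⊢
      by_cases huw : w = u
      · exact Or.inl huw
      · refine Or.inr ⟨⟨Ne.symm huw, norm_sub_le_of_coord hL hr fun i => ?_⟩, hw.2⟩
        have h1 := cellOf_le hL (hx u) i
        have h2 := cellOf_le hL (hx w) i
        rw [hu] at h1
        rw [hw.1] at h2
        rw [abs_le]; constructor <;> linarith [h1.1, h1.2, h2.1, h2.2]
    have h2 := (Finset.card_le_card h1).trans (Finset.card_union_le _ _)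
    have h4 := hH u
    rw [Finset.card_singleton] at h2
    omega
  -- The two disjoint halves in any one direction give `2 * (D + 4)` points.
  · set j : Fin d := ⟨0, hd⟩
    have hdis : Disjoint (Finset.univ.filter fun i => x i ∈ halfCell q j true)
        (Finset.univ.filter fun i => x i ∈ halfCell q j false) := by
      rw [Finset.disjoint_left]
      intro i h1 h2
      simp only [Finset.mem_filter, Finset.mem_univ, true_and, mem_halfCell hL] at h1 h2
      have h1 := h1 j
      have h2 := h2 j
      simp only [true_and, if_true, Bool.true_eq_false, Bool.false_eq_true, if_false] at h1 h2
      linarith [h1.1, h2.2]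
    have h1 := Finset.card_le_card (Finset.union_subset (hhalf q j true) (hhalf q j false))
    rw [Finset.card_union_of_disjoint hdis] at h1
    have h2 := hcount q j true
    have h3 := hcount q j false
    omega
  · intro q q' hqq'
    rw [Finset.disjoint_left]
    intro i h1 h2
    rw [hmemB] at h1 h2
    exact hqq' (h1.symm.trans h2)
  · refine hch.imp ?_
    rintro q q' ⟨j, hq, hj | hj⟩
    · refine hlink ?_ (hnext hq hj)
      rintro rfl; omega
    · refine hlink (j := j) (upper := false) (upper' := true) ?_ fun y hy z hz i => ?_
      · rintro rfl; omega
      · rw [abs_sub_comm]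
        exact hnext (fun i hi => (hq i hi).symm) hj z hz y hy i

end Grid

/-! ### Bounding the probability of failure -/

section Resilience

variable {d : ℕ}

open Classical in
lemma IsAlphaSubgraph.card_deleted_le {V : Type*} [Fintype V] {α : ℝ} {H G : SimpleGraph V}
    (h : IsAlphaSubgraph α H G) (v : V) :
    ((Finset.univ.filter fun u => G.Adj v u ∧ ¬ H.Adj v u).card : ℝ) ≤
      (1 - α) * (Finset.univ.filter (G.Adj v)).card := by
  have h1 := h.2 v
  have hG : G.degree v = (Finset.univ.filter (G.Adj v)).card := by
    rw [← SimpleGraph.card_neighborFinset_eq_degree, SimpleGraph.neighborFinset_eq_filter]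
  have hH : H.degree v = (Finset.univ.filter (H.Adj v)).card := by
    rw [← SimpleGraph.card_neighborFinset_eq_degree, SimpleGraph.neighborFinset_eq_filter]
  rw [hG, hH] at h1
  have h2 : (Finset.univ.filter fun u => G.Adj v u ∧ ¬ H.Adj v u).card +
      (Finset.univ.filter (H.Adj v)).card = (Finset.univ.filter (G.Adj v)).card := by
    rw [← Finset.card_filter_add_card_filter_not (s := Finset.univ.filter (G.Adj v)) (H.Adj v),
      Finset.filter_filter, Finset.filter_filter, add_comm]
    congr 2
    ext u
    simp only [Finset.mem_filter, Finset.mem_univ, true_and]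
    exact ⟨fun hu => ⟨h.1 hu, hu⟩, fun hu => hu.2⟩
  have h3 : ((Finset.univ.filter fun u => G.Adj v u ∧ ¬ H.Adj v u).card : ℝ) +
      (Finset.univ.filter (H.Adj v)).card = (Finset.univ.filter (G.Adj v)).card := by
    exact_mod_cast h2
  linarith

open Classical in
lemma countIn_eq_card {E ι : Type*} [Fintype ι] (S : Set E) (x : ι → E) :
    countIn S x = (Finset.univ.filter fun i => x i ∈ S).card := by
  simp [countIn, Set.indicator_apply]

/-- The pairs of points at distance at most `r`. -/
def closePairs (d : ℕ) (r : ℝ) :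
    Set (EuclideanSpace ℝ (Fin d) × EuclideanSpace ℝ (Fin d)) :=
  {z | ‖z.1 - z.2‖ ≤ r}

open Classical in
-- Leaving out the point `v` itself expresses the degree through points independent of `x v`, as
-- `relation_upper_tail` requires.
lemma card_neighbors_le {n : ℕ} (r : ℝ) (x : Fin (n + 1) → EuclideanSpace ℝ (Fin d))
    (v : Fin (n + 1)) : ((Finset.univ.filter ((geometricGraph r x).Adj v)).card : ℝ) ≤
      countIn (Prod.mk (x v) ⁻¹' closePairs d r) fun j => x (v.succAbove j) := by
  rw [countIn_eq_card, Nat.cast_le]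
  rw [← Finset.card_map v.succAboveEmb]
  refine Finset.card_le_card fun u hu => ?_
  simp only [Finset.mem_filter, Finset.mem_univ, true_and] at hu
  obtain ⟨j, rfl⟩ := Fin.exists_succAbove_eq hu.1.symm
  rw [Finset.mem_map]
  exact ⟨j, Finset.mem_filter.2 ⟨Finset.mem_univ _, hu.2⟩, rfl⟩

/-- Resilience of Hamiltonicity with an explicit bound for the probability of failure. -/
lemma uniformPoints_compl_le (hd : 1 ≤ d) {L n : ℕ} (hL : 0 < L) (hn : 0 < n) {r α δ : ℝ}
    (hr0 : 0 ≤ r) (hr : Real.sqrt d ≤ r * L) (hα : α ≤ 1) (hδ : 0 ≤ δ) (hδ1 : δ ≤ 1)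
    (hroom : (1 - α) * ((1 + δ) * (n * (unitBallVolume d * r ^ d))) + 4 ≤
      (1 - δ) * (n * (1 / (2 * (L : ℝ) ^ d)))) :
    uniformPoints d n {x | ∀ H : SimpleGraph (Fin n),
        IsAlphaSubgraph α H (geometricGraph r x) → H.IsHamiltonian}ᶜ ≤
      ENNReal.ofReal (L ^ d * (d * 2) *
          Real.exp (-(δ ^ 2 / 4 * (n * (1 / (2 * (L : ℝ) ^ d))))) +
        n * Real.exp (-(δ ^ 2 / 4 * (n * (unitBallVolume d * r ^ d))))) := by
  classical
  obtain ⟨n, rfl⟩ : ∃ k, n = k + 1 := ⟨n - 1, by omega⟩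
  set s : ℝ := (n + 1 : ℕ) * (1 / (2 * (L : ℝ) ^ d)) with hs
  set m : ℝ := (n + 1 : ℕ) * (unitBallVolume d * r ^ d) with hm
  have hθ : 0 ≤ unitBallVolume d := ENNReal.toReal_nonneg
  have hm0 : 0 ≤ m := by positivity
  set U : (Fin d → Fin L) × Fin d × Bool → Set (Fin (n + 1) → EuclideanSpace ℝ (Fin d)) :=
    fun c => {x | countIn (halfCell c.1 c.2.1 c.2.2) x ≤ (1 - δ) * s} with hU
  set W : Fin (n + 1) → Set (Fin (n + 1) → EuclideanSpace ℝ (Fin d)) :=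
    fun v => {x | (1 + δ) * m ≤
      countIn (Prod.mk (x v) ⁻¹' closePairs d r) fun j => x (v.succAbove j)} with hW
  have hUle : ∀ c, uniformPoints d (n + 1) (U c) ≤
      ENNReal.ofReal (Real.exp (-(δ ^ 2 / 4 * s))) := by
    intro c
    rw [← ofReal_measureReal]
    refine ENNReal.ofReal_le_ofReal (countIn_lower_tail (uniformCube d) (n + 1)
      (measurableSet_boxIco _ _) hδ hδ1 (by positivity) ?_)
    exact (congrArg _ (uniformCube_halfCell hL c.1 c.2.1 c.2.2)).ge
  have hT : MeasurableSet (closePairs d r) :=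
    measurableSet_le (by fun_prop) measurable_const
  have hWle : ∀ v, uniformPoints d (n + 1) (W v) ≤
      ENNReal.ofReal (Real.exp (-(δ ^ 2 / 4 * m))) := by
    intro v
    refine relation_upper_tail (uniformCube d) n hT hδ hδ1 (fun y => ?_) v
    have h1 := uniformCube_closedBall_le y hr0
    refine mul_le_mul ?_ h1 measureReal_nonneg (by positivity)
    exact_mod_cast Nat.le_succ n
  have hsub : {x | ∀ H : SimpleGraph (Fin (n + 1)),
      IsAlphaSubgraph α H (geometricGraph r x) → H.IsHamiltonian}ᶜ ⊆
      -- Failure requires a point outside the cube (a null event), an underfull half cube, or a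
      -- vertex of too large degree.
      {x | ∀ i, x i ∈ unitCube d}ᶜ ∪ ((⋃ c, U c) ∪ ⋃ v, W v) := by
    intro x hx
    by_contra hgood
    simp only [Set.mem_union, Set.mem_compl_iff, not_or, not_not, Set.mem_iUnion,
      not_exists] at hgood
    obtain ⟨hcube, hcount, hdeg⟩ := hgood
    refine hx fun H hH => ?_
    have h1α : 0 ≤ 1 - α := by linarith
    refine isHamiltonian_of_halfCell hd hL hr hcube
      (D := ⌊(1 - α) * ((1 + δ) * m)⌋₊) (fun q j upper => ?_) fun v => ?_
    · have h1 := hcount (q, j, upper)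
      simp only [hU, Set.mem_ofPred_eq, not_le, countIn_eq_card] at h1
      have h2 := Nat.floor_le (show 0 ≤ (1 - α) * ((1 + δ) * m) by positivity)
      have : ((⌊(1 - α) * ((1 + δ) * m)⌋₊ + 4 : ℕ) : ℝ) ≤
          ((Finset.univ.filter fun i => x i ∈ halfCell q j upper).card : ℝ) := by
        push_cast; linarith
      exact_mod_cast this
    · refine Nat.le_floor ((hH.card_deleted_le v).trans ?_)
      refine mul_le_mul_of_nonneg_left ((card_neighbors_le r x v).trans ?_) h1α
      have h1 := hdeg v
      simp only [hW, Set.mem_ofPred_eq, not_le] at h1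
      exact h1.le
  refine (measure_mono hsub).trans ((measure_union_le _ _).trans ?_)
  have h0 : uniformPoints d (n + 1) {x | ∀ i, x i ∈ unitCube d}ᶜ = 0 := ae_mem_unitCube d (n + 1)
  rw [h0, zero_add, ENNReal.ofReal_add (by positivity) (by positivity)]
  refine (measure_union_le _ _).trans (add_le_add ?_ ?_)
  · refine (measure_iUnion_fintype_le _ _).trans ((Finset.sum_le_sum fun c _ => hUle c).trans ?_)
    rw [Finset.sum_const, nsmul_eq_mul, ENNReal.ofReal_mul (by positivity)]
    refine mul_le_mul_left (le_of_eq ?_) _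
    simp only [Finset.card_univ, Fintype.card_prod, Fintype.card_fun, Fintype.card_fin,
      Fintype.card_bool]
    rw [← ENNReal.ofReal_natCast]
    push_cast; rfl
  · refine (measure_iUnion_fintype_le _ _).trans ((Finset.sum_le_sum fun c _ => hWle c).trans ?_)
    rw [Finset.sum_const, nsmul_eq_mul, ENNReal.ofReal_mul (by positivity), Finset.card_univ,
      Fintype.card_fin, ENNReal.ofReal_natCast]

end Resilience

/-! ### Choice of constants and the limit -/

section Asymptotics

variable {d : ℕ}

lemma unitBallVolume_pos (d : ℕ) : 0 < unitBallVolume d :=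
  ENNReal.toReal_pos (Metric.measure_ball_pos _ _ one_pos).ne' measure_ball_lt_top.ne

/-- The bound of `uniformPoints_compl_le` when `r` is small and `n * r ^ d` is large compared
with `log n`; here `A = d ^ (d / 2)`. -/
lemma uniformPoints_compl_le_div (hd : 1 ≤ d) {n : ℕ} {r ε A δ : ℝ} (hn : 0 < n) (hr : 0 < r)
    (hA : A = Real.sqrt d ^ d) (hε : 0 < ε) (hε' : ε ≤ 1 / (2 * A * unitBallVolume d))
    (hδ : δ = ε * unitBallVolume d * A / 3)
    (hrsmall : (Real.sqrt d + r) ^ d ≤ A * (1 + δ))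
    (hY1 : 1 ≤ n * r ^ d) (hY2 : 8 / (ε * unitBallVolume d) ≤ n * r ^ d)
    (hY3 : 2 * Real.log n ≤ δ ^ 2 / (16 * A) * (n * r ^ d))
    (hY4 : 2 * Real.log n ≤ δ ^ 2 * unitBallVolume d / 4 * (n * r ^ d)) :
    uniformPoints d n {x | ∀ H : SimpleGraph (Fin n),
        IsAlphaSubgraph (1 - 1 / (2 * A * unitBallVolume d) + ε) H (geometricGraph r x) →
          H.IsHamiltonian}ᶜ ≤
      ENNReal.ofReal ((4 * A * d + 1) / n) := by
  have hd' : (0 : ℝ) < d := by exact_mod_cast hd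
  have hsq : 0 < Real.sqrt d := Real.sqrt_pos.2 hd'
  have hA0 : 0 < A := hA ▸ pow_pos hsq d
  have hθ := unitBallVolume_pos d
  set θ := unitBallVolume d with hθdef
  have hn' : (0 : ℝ) < n := by exact_mod_cast hn
  have hδ0 : 0 < δ := by rw [hδ]; positivity
  have hδ1 : δ ≤ 1 / 6 := by
    rw [le_div_iff₀ (by positivity)] at hε'
    rw [hδ]; linarith
  set L := ⌈Real.sqrt d / r⌉₊ with hLdef
  have hL : 0 < L := Nat.ceil_pos.2 (by positivity)
  have hL' : (0 : ℝ) < L := by exact_mod_cast hL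
  have hrL : Real.sqrt d ≤ r * L := by
    have := Nat.le_ceil (Real.sqrt d / r)
    rw [div_le_iff₀ hr] at this
    linarith
  have hLr : L * r ≤ Real.sqrt d + r := by
    have := (Nat.ceil_lt_add_one (show 0 ≤ Real.sqrt d / r by positivity)).le
    calc L * r ≤ (Real.sqrt d / r + 1) * r := by gcongr
      _ = Real.sqrt d + r := by field_simp
  have hLrd : (L : ℝ) ^ d * r ^ d ≤ A * (1 + δ) := by
    rw [← mul_pow]; exact (pow_le_pow_left₀ (by positivity) hLr d).trans hrsmall
  set Y := n * r ^ d with hY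
  have hY0 : 0 < Y := by positivity
  have hLd : (0 : ℝ) < (L : ℝ) ^ d := by positivity
  have hsY : Y / (2 * (A * (1 + δ))) ≤ n * (1 / (2 * (L : ℝ) ^ d)) := by
    rw [mul_one_div, div_le_div_iff₀ (by positivity) (by positivity), hY]
    have := mul_le_mul_of_nonneg_left hLrd hn'.le
    linarith
  -- Both sides have main term `Y / (2 * A)`. The errors cost at most `3 * δ * Y / (2 * A) = ε * θ *
  -- Y / 2`, by the choice of `δ`; the `ε` in α gains at least `ε * θ * Y`. The remaining `ε * θ * Y
  -- / 2` is at least `4` by `hY2`.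
  have hroom : (1 - (1 - 1 / (2 * A * θ) + ε)) * ((1 + δ) * (n * (θ * r ^ d))) + 4 ≤
      (1 - δ) * (n * (1 / (2 * (L : ℝ) ^ d))) := by
    have h1 : (1 - 2 * δ) * (Y / (2 * A)) ≤ (1 - δ) * (Y / (2 * (A * (1 + δ)))) := by
      have : (1 - δ) * (Y / (2 * (A * (1 + δ)))) = (1 - δ) / (1 + δ) * (Y / (2 * A)) := by
        field_simp
      rw [this]
      refine mul_le_mul_of_nonneg_right ?_ (by positivity)
      rw [le_div_iff₀ (by positivity)]
      nlinarith
    have h2 := mul_le_mul_of_nonneg_left hsY (show 0 ≤ 1 - δ by linarith)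
    refine le_trans ?_ (h1.trans h2)
    have h3 : (1 - (1 - 1 / (2 * A * θ) + ε)) * ((1 + δ) * (n * (θ * r ^ d))) =
        (1 + δ) * (Y / (2 * A)) - ε * θ * (1 + δ) * Y := by
      rw [hY]; field_simp; ring
    have h4 : δ * (Y / (2 * A)) = ε * θ * Y / 6 := by
      rw [hδ]; field_simp; norm_num
    have h5 : 8 ≤ ε * θ * Y := by
      rw [div_le_iff₀ (by positivity)] at hY2; linarith
    have h6 : 0 ≤ δ * (ε * θ * Y) := by positivity
    rw [h3]
    linarith
  refine (uniformPoints_compl_le hd hL hn hr.le hrL (by linarith) hδ0.le (by linarith)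
    hroom).trans (ENNReal.ofReal_le_ofReal ?_)
  -- Each bad event has probability at most `1 / n ^ 2`, and there are only `O(n)` of them because
  -- `n * r ^ d ≥ 1` bounds `L ^ d` by a multiple of `n`.
  have hexp : ∀ t : ℝ, 2 * Real.log n ≤ t → Real.exp (-t) ≤ 1 / (n : ℝ) ^ 2 := by
    intro t ht
    rw [Real.exp_neg, ← one_div]
    refine one_div_le_one_div_of_le (by positivity) ?_
    calc (n : ℝ) ^ 2 = Real.exp (2 * Real.log n) := by
          rw [two_mul, Real.exp_add, Real.exp_log hn']; ring
      _ ≤ _ := Real.exp_le_exp.2 ht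
  have e1 : Real.exp (-(δ ^ 2 / 4 * (n * (1 / (2 * (L : ℝ) ^ d))))) ≤ 1 / (n : ℝ) ^ 2 := by
    refine hexp _ (hY3.trans ?_)
    have h1 : Y / (4 * A) ≤ Y / (2 * (A * (1 + δ))) :=
      div_le_div_of_nonneg_left hY0.le (by positivity) (by nlinarith)
    calc _ = δ ^ 2 / 4 * (Y / (4 * A)) := by field_simp; norm_num
      _ ≤ _ := by gcongr; exact h1.trans hsY
  have e2 : Real.exp (-(δ ^ 2 / 4 * (n * (θ * r ^ d)))) ≤ 1 / (n : ℝ) ^ 2 := by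
    refine hexp _ (hY4.trans_eq ?_)
    rw [hY]; ring
  have e3 : (L : ℝ) ^ d ≤ 2 * A * n := by
    have h1 : (L : ℝ) ^ d ≤ (L : ℝ) ^ d * Y := le_mul_of_one_le_right hLd.le hY1
    have h2 := mul_le_mul_of_nonneg_left hLrd hn'.le
    have h3 : n * (A * (1 + δ)) ≤ n * (A * 2) := by gcongr; linarith
    rw [hY] at h1
    linarith
  calc _ ≤ 2 * A * n * (d * 2) * (1 / (n : ℝ) ^ 2) + n * (1 / (n : ℝ) ^ 2) := by gcongr
    _ = _ := by field_simp; ring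

end Asymptotics

theorem theorem1p8 (d : ℕ) (hd : 1 ≤ d) (ε : ℝ) (hε : 0 < ε)
    (hε' : ε ≤ 1 / (2 * (d : ℝ) ^ ((d : ℝ) / 2) * unitBallVolume d)) :
    ∃ C : ℝ, 0 < C ∧ ∀ r : ℕ → ℝ,
      (∀ᶠ n : ℕ in atTop, C * (Real.log n / n) ^ (1 / (d : ℝ)) ≤ r n) →
      Tendsto r atTop (𝓝 0) →
      Tendsto
        (fun n : ℕ => uniformPoints d n
          {x | ∀ H : SimpleGraph (Fin n),
            IsAlphaSubgraph (1 - 1 / (2 * (d : ℝ) ^ ((d : ℝ) / 2) * unitBallVolume d) + ε)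
              H (geometricGraph (r n) x) → H.IsHamiltonian})
        atTop (𝓝 1) := by
  have hd' : (0 : ℝ) < d := by exact_mod_cast hd
  have hsq : 0 < Real.sqrt d := Real.sqrt_pos.2 hd'
  have hθ := unitBallVolume_pos d
  obtain ⟨A, hA⟩ : ∃ A, A = (d : ℝ) ^ ((d : ℝ) / 2) := ⟨_, rfl⟩
  have hA' : A = Real.sqrt d ^ d := by
    rw [hA, Real.sqrt_eq_rpow, ← Real.rpow_natCast, ← Real.rpow_mul hd'.le]
    ring_nf
  have hA0 : 0 < A := hA' ▸ pow_pos hsq d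
  rw [← hA] at hε' ⊢
  obtain ⟨δ, hδ⟩ : ∃ δ, δ = ε * unitBallVolume d * A / 3 := ⟨_, rfl⟩
  have hδ0 : 0 < δ := by rw [hδ]; positivity
  set c := min (δ ^ 2 / (16 * A)) (δ ^ 2 * unitBallVolume d / 4) with hc
  have hc0 : 0 < c := lt_min (by positivity) (by positivity)
  -- The term `2 / c` makes both Chernoff exponents at least `2 * log n`; the `1` gives `C ≤ C ^ d`
  -- and `log n ≤ n * r ^ d`.
  refine ⟨max 1 (2 / c), by positivity, fun r hlow hr0 => ?_⟩
  have hC1 : 1 ≤ max 1 (2 / c) := le_max_left _ _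
  set C := max 1 (2 / c) with hC
  have hlog : Tendsto (fun n : ℕ => Real.log n) atTop atTop :=
    Real.tendsto_log_atTop.comp tendsto_natCast_atTop_atTop
  -- Here `r → 0` enters: rounding `√d / r` up to an integer becomes negligible.
  have hcont : ∀ᶠ n in atTop, (Real.sqrt d + r n) ^ d ≤ A * (1 + δ) := by
    have h : Tendsto (fun n => (Real.sqrt d + r n) ^ d) atTop (𝓝 ((Real.sqrt d + 0) ^ d)) :=
      (hr0.const_add _).pow d
    rw [add_zero, ← hA'] at h
    exact (h.eventually_lt_const (by nlinarith)).mono fun n hn => hn.le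
  have hfail : Tendsto (fun n : ℕ => ENNReal.ofReal ((4 * A * d + 1) / n)) atTop (𝓝 0) := by
    rw [← ENNReal.ofReal_zero]
    exact ENNReal.tendsto_ofReal (tendsto_const_div_atTop_nhds_zero_nat _)
  have hbound : ∀ᶠ n : ℕ in atTop, 1 - ENNReal.ofReal ((4 * A * d + 1) / n) ≤
      uniformPoints d n {x | ∀ H : SimpleGraph (Fin n),
        IsAlphaSubgraph (1 - 1 / (2 * A * unitBallVolume d) + ε)
          H (geometricGraph (r n) x) → H.IsHamiltonian} := by
    filter_upwards [hlow, hcont, eventually_gt_atTop 0, hlog.eventually_ge_atTop 1,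
      hlog.eventually_ge_atTop (8 / (ε * unitBallVolume d))] with n h1 h2 h3 h4 h5
    have hn' : (0 : ℝ) < n := by exact_mod_cast h3
    have hq : 0 < Real.log n / n := by positivity
    have hrn : 0 < r n := lt_of_lt_of_le (by positivity) h1
    have hY : C * Real.log n ≤ n * r n ^ d := by
      have h6 := pow_le_pow_left₀ (by positivity) h1 d
      rw [mul_pow, ← Real.rpow_natCast (_ ^ _), ← Real.rpow_mul hq.le, one_div,
        inv_mul_cancel₀ hd'.ne', Real.rpow_one] at h6
      calc C * Real.log n ≤ C ^ d * Real.log n := by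
            gcongr; exact le_self_pow₀ hC1 (by omega)
        _ = n * (C ^ d * (Real.log n / n)) := by field_simp
        _ ≤ _ := by gcongr
    have hY1 : Real.log n ≤ n * r n ^ d :=
      (le_mul_of_one_le_left (by linarith) hC1).trans hY
    have hY2 : 2 * Real.log n ≤ c * (n * r n ^ d) := by
      have h7 : 2 ≤ c * C := by
        have := mul_le_mul_of_nonneg_left (le_max_right 1 (2 / c)) hc0.le
        rwa [mul_div_cancel₀ _ hc0.ne'] at this
      calc 2 * Real.log n ≤ c * C * Real.log n := by gcongr
        _ = c * (C * Real.log n) := by ring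
        _ ≤ _ := by gcongr
    have hYp : 0 ≤ n * r n ^ d := by positivity
    have key := uniformPoints_compl_le_div hd h3 hrn hA' hε hε' hδ h2 (h4.trans hY1) (h5.trans hY1)
      (hY2.trans (mul_le_mul_of_nonneg_right (min_le_left _ _) hYp))
      (hY2.trans (mul_le_mul_of_nonneg_right (min_le_right _ _) hYp))
    rw [tsub_le_iff_right]
    refine le_trans ?_ (add_le_add_right key _)
    -- Subadditivity suffices, so measurability of the event is not needed.
    rw [← measure_univ (μ := uniformPoints d n), ← Set.union_compl_self]
    exact measure_union_le _ _
  refine tendsto_of_tendsto_of_tendsto_of_le_of_le' ?_ tendsto_const_nhds hbound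
    (Eventually.of_forall fun n => prob_le_one)
  simpa using ENNReal.Tendsto.sub tendsto_const_nhds hfail (Or.inl ENNReal.one_ne_top)
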